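/- Let $A$ be a finite dimensional $C^*$-algebra, $H$ a finite dimensional complex Hilbert space, and $t$ the transpose map on $B(H)$ with respect to a fixed orthonormal basis of $H$. A linear map $\psi\colon A\to B(H)$ is positive if it carries positive elements to positive operators, $k$-positive if the map $\iota_k\otimes\psi\colon M_k\otimes A\to M_k\otimes B(H)$ is positive (where $\iota_k$ is the identity map of the complex $k\times k$ matrices $M_k$), and completely positive if it is $k$-positive for all $k$; it is $k$-co-positive (resp. co-positive) if $t\circ\psi$ is $k$-positive (resp. completely positive). It is decomposable if it is the sum of a completely positive and a co-positive map, and $2$-decomposable if it is the sum of a $2$-positive and a $2$-co-positive map; it is atomic if it is not $2$-decomposable. Write $\psi\le\phi$, and say that $\phi$ majorizes $\psi$, if $\phi-\psi$ is positive. Let $\phi\colon A\to B(H)$ be a positive linear map. Then there are linear maps $\alpha,\beta\colon A\to B(H)$ with $\phi=\alpha+\beta$ such that (1) $\alpha$ is a maximal decomposable map majorized by $\phi$: $\alpha$ is decomposable, $\alpha\le\phi$, and there is no decomposable map $\psi\ne\alpha$ with $\alpha\le\psi\le\phi$; (2) $\beta$ is positive and bi-optimal: every completely positive map and every co-positive map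 majorized by $\beta$ is zero; (3) if $\beta\neq 0$, then $\beta$ is atomic. -/

import Mathlib

namespace PositiveMap

/-- The transpose map on `B(H)` with respect to the orthonormal basis `b` of `H`: the operator with
matrix `M` in the basis `b` is sent to the operator with matrix `Mᵀ` in the basis `b`. -/
noncomputable def transposeMap {H : Type*} [NormedAddCommGroup H] [InnerProductSpace ℂ H]
    [FiniteDimensional ℂ H] {ι : Type*} [Fintype ι] [DecidableEq ι]
    (b : OrthonormalBasis ι ℂ H) : (H →L[ℂ] H) →ₗ[ℂ] (H →L[ℂ] H) where
  toFun x := LinearMap.toContinuousLinearMap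
    (Matrix.toLin b.toBasis b.toBasis
      (LinearMap.toMatrix b.toBasis b.toBasis (x : H →ₗ[ℂ] H)).transpose)
  map_add' x y := by simp
  map_smul' c x := by simp

section

variable {A : Type*} [CStarAlgebra A] [PartialOrder A] [StarOrderedRing A]
variable {H : Type*} [NormedAddCommGroup H] [InnerProductSpace ℂ H] [CompleteSpace H]

/-- A linear map `φ : A → B(H)` is positive if it carries positive elements to positive
operators. -/
def IsPositive (φ : A →ₗ[ℂ] (H →L[ℂ] H)) : Prop :=
  ∀ a : A, 0 ≤ a → 0 ≤ φ a

/-- `ψ` majorizes `φ`, i.e. `φ ≤ ψ`: the map `ψ - φ` is positive. -/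
def Majorizes (ψ φ : A →ₗ[ℂ] (H →L[ℂ] H)) : Prop :=
  IsPositive (ψ - φ)

/-- `φ` is `k`-positive: applying `φ` entrywise carries positive elements of `M_k(A)` to positive
elements of `M_k(B(H))`. -/
def IsKPositive (k : ℕ) (φ : A →ₗ[ℂ] (H →L[ℂ] H)) : Prop :=
  ∀ M : CStarMatrix (Fin k) (Fin k) A, 0 ≤ M → 0 ≤ M.map φ

/-- `φ` is completely positive: it is `k`-positive for all `k`. -/
def IsCompletelyPositive (φ : A →ₗ[ℂ] (H →L[ℂ] H)) : Prop :=
  ∀ k : ℕ, IsKPositive k φ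

/-- `φ` is optimal: it majorizes no completely positive map except `0`. -/
def IsOptimal (φ : A →ₗ[ℂ] (H →L[ℂ] H)) : Prop :=
  ∀ ψ : A →ₗ[ℂ] (H →L[ℂ] H), IsCompletelyPositive ψ → Majorizes φ ψ → ψ = 0

end

section

variable {A : Type*} [CStarAlgebra A] [PartialOrder A] [StarOrderedRing A]
variable {H : Type*} [NormedAddCommGroup H] [InnerProductSpace ℂ H] [FiniteDimensional ℂ H]
  [CompleteSpace H]
variable {ι : Type*} [Fintype ι] [DecidableEq ι]

/-- `φ` is `k`-co-positive: its composition with the transpose map is `k`-positive. -/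
def IsKCopositive (b : OrthonormalBasis ι ℂ H) (k : ℕ) (φ : A →ₗ[ℂ] (H →L[ℂ] H)) : Prop :=
  IsKPositive k (transposeMap b ∘ₗ φ)

/-- `φ` is co-positive: its composition with the transpose map is completely positive. -/
def IsCopositive (b : OrthonormalBasis ι ℂ H) (φ : A →ₗ[ℂ] (H →L[ℂ] H)) : Prop :=
  IsCompletelyPositive (transposeMap b ∘ₗ φ)

/-- `φ` is `k`-decomposable: it is the sum of a `k`-positive and a `k`-co-positive map. -/
def IsKDecomposable (b : OrthonormalBasis ι ℂ H) (k : ℕ) (φ : A →ₗ[ℂ] (H →L[ℂ] H)) : Prop :=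
  ∃ φ₁ φ₂ : A →ₗ[ℂ] (H →L[ℂ] H), IsKPositive k φ₁ ∧ IsKCopositive b k φ₂ ∧ φ = φ₁ + φ₂

/-- `φ` is decomposable: it is the sum of a completely positive and a co-positive map. -/
def IsDecomposable (b : OrthonormalBasis ι ℂ H) (φ : A →ₗ[ℂ] (H →L[ℂ] H)) : Prop :=
  ∃ φ₁ φ₂ : A →ₗ[ℂ] (H →L[ℂ] H), IsCompletelyPositive φ₁ ∧ IsCopositive b φ₂ ∧ φ = φ₁ + φ₂

/-- `φ` is atomic: it is not `2`-decomposable. -/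
def IsAtomic (b : OrthonormalBasis ι ℂ H) (φ : A →ₗ[ℂ] (H →L[ℂ] H)) : Prop :=
  ¬ IsKDecomposable b 2 φ

/-- `φ` is co-optimal: it majorizes no co-positive map except `0`. -/
def IsCooptimal (b : OrthonormalBasis ι ℂ H) (φ : A →ₗ[ℂ] (H →L[ℂ] H)) : Prop :=
  ∀ ψ : A →ₗ[ℂ] (H →L[ℂ] H), IsCopositive b ψ → Majorizes φ ψ → ψ = 0

/-- `φ` is bi-optimal: it is both optimal and co-optimal. -/
def IsBioptimal (b : OrthonormalBasis ι ℂ H) (φ : A →ₗ[ℂ] (H →L[ℂ] H)) : Prop :=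
  IsOptimal φ ∧ IsCooptimal b φ

/-- `α` is a maximal decomposable map majorized by `φ`: it is decomposable, `α ≤ φ`, and there is
no decomposable map `ψ ≠ α` with `α ≤ ψ ≤ φ`. -/
def IsMaximalDecomposable (b : OrthonormalBasis ι ℂ H) (φ α : A →ₗ[ℂ] (H →L[ℂ] H)) : Prop :=
  IsDecomposable b α ∧ Majorizes φ α ∧
    ¬ ∃ ψ : A →ₗ[ℂ] (H →L[ℂ] H),
      IsDecomposable b ψ ∧ ψ ≠ α ∧ Majorizes ψ α ∧ Majorizes φ ψ

end

end PositiveMap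

/-! The map `α` comes from compactness. In finite dimensions the pairs (completely positive,
co-positive) whose sum lies below `φ` form a compact set; a pair maximising a faithful functional of
the value of its sum at `1` gives a maximal `α`. Then `β = φ - α` is bi-optimal, since a nonzero
completely positive or co-positive map below `β` could be added to `α`.

Atomicity rests on `IsKPositive.exists_completelyPositive_le`: below a nonzero 2-positive `φ` there
is a nonzero completely positive `ψ`. Choose a minimal projection `e` with `φ e ≠ 0` and a vector
`η` with `⟨η, φ(e)η⟩ = 1`. Left multiplication on the Hilbert space `Ae` yields a completely
positive `ψ` with `⟨ξ, ψ(b* b)ξ⟩ = |⟨η, φ(b)ξ⟩|²` for `b ∈ eA`. Since minimal projections generate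
the positive cone, `ψ ≤ φ` need only be tested on them. Each is either killed by `ψ` or a positive
multiple of some `b* b` with `b ∈ eA`, where the claim is the Cauchy–Schwarz inequality
`IsKPositive.norm_inner_sq_le`.

Composing with the transpose gives the co-positive version. Hence a nonzero summand in a
2-decomposition of `β` would contradict bi-optimality. -/

namespace PositiveMap

/-! ### Minimal projections generate the positive cone -/

section ProjectionCone

variable {A : Type*} [CStarAlgebra A]

/-- A minimal projection: a nonzero self-adjoint idempotent `e` with `e A e = ℂ e`. -/
structure IsMinimalProjection (e : A) : Prop where
  isSelfAdjoint : star e = e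
  mul_self : e * e = e
  ne_zero : e ≠ 0
  corner : ∀ a : A, ∃ c : ℂ, e * a * e = c • e

variable [PartialOrder A] [StarOrderedRing A]

theorem IsMinimalProjection.nonneg {e : A} (he : IsMinimalProjection e) : 0 ≤ e := by
  have h := star_mul_self_nonneg e
  rwa [he.isSelfAdjoint, he.mul_self] at h

omit [PartialOrder A] [StarOrderedRing A] in
theorem IsMinimalProjection.smul_inj {e : A} (he : IsMinimalProjection e) {c d : ℂ}
    (h : c • e = d • e) : c = d :=
  smul_left_injective ℂ he.ne_zero h

theorem IsMinimalProjection.exists_real_of_smul_nonneg {e : A} (he : IsMinimalProjection e) {c : ℂ}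
    (h : 0 ≤ c • e) : ∃ r : ℝ, 0 ≤ r ∧ c = r := by
  have h1 : IsSelfAdjoint (c • e) := IsSelfAdjoint.of_nonneg h
  have h2 : (starRingEnd ℂ c) • e = c • e := by
    have := h1.star_eq
    rwa [star_smul, he.isSelfAdjoint] at this
  obtain ⟨r, rfl⟩ := Complex.conj_eq_iff_real.1 (he.smul_inj h2)
  refine ⟨r, ?_, rfl⟩
  by_contra hr
  push Not at hr
  have h3 : 0 ≤ (-r) • e := smul_nonneg (by linarith) he.nonneg
  have h4 : r • e = 0 := by
    apply le_antisymm
    · simpa using h3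
    · rwa [Complex.coe_smul] at h
  rcases smul_eq_zero.1 h4 with h5 | h5
  · exact hr.ne h5
  · exact he.ne_zero h5

/-- Every nonzero positive element is strictly positive under some positive functional. -/
theorem exists_positive_functional_pos {x : A} (hx : 0 ≤ x) (hx0 : x ≠ 0) :
    ∃ f : A →L[ℝ] ℝ, (∀ y, 0 ≤ y → 0 ≤ f y) ∧ 0 < f x := by
  let C : ProperCone ℝ A :=
    { carrier := {y | 0 ≤ y}
      add_mem' := fun ha hb => add_nonneg ha hb
      zero_mem' := le_refl (0 : A)
      smul_mem' := fun c _ ha => smul_nonneg c.2 ha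
      isClosed' := CStarAlgebra.isClosed_nonneg }
  have hC : ∀ y, y ∈ C ↔ 0 ≤ y := fun y => Iff.rfl
  have hn : -x ∉ C := fun h => hx0 (le_antisymm (neg_nonneg.1 ((hC _).1 h)) hx)
  obtain ⟨f, hf, hfx⟩ := C.hyperplane_separation_point hn
  exact ⟨f, fun y hy => hf y hy, by simpa using hfx⟩

/-- A finite dimensional C⋆-algebra has a faithful positive functional. -/
theorem exists_faithful_functional [FiniteDimensional ℂ A] :
    ∃ f : A →L[ℝ] ℝ, ∀ y, 0 ≤ y → y ≠ 0 → 0 < f y := by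
  have : FiniteDimensional ℝ A := FiniteDimensional.complexToReal A
  have : ProperSpace A := FiniteDimensional.proper ℝ A
  have hK : IsCompact ({y : A | 0 ≤ y} ∩ Metric.sphere 0 1) :=
    (isCompact_sphere (0 : A) 1).inter_left CStarAlgebra.isClosed_nonneg
  have hne : ∀ y ∈ ({y : A | 0 ≤ y} ∩ Metric.sphere 0 1), y ≠ 0 := by
    rintro y ⟨-, hy⟩ rfl
    simp at hy
  choose! F hF0 hF using fun (x : A) (h : 0 ≤ x ∧ x ≠ 0) => exists_positive_functional_pos h.1 h.2
  -- Finitely many functionals suffice on the compact set of positive unit vectors; their sum is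
  -- faithful.
  obtain ⟨t, ht, hcov⟩ := hK.elim_nhds_subcover (fun x => {y | 0 < F x y}) (fun x hx =>
    (isOpen_lt continuous_const (F x).continuous).mem_nhds (hF x ⟨hx.1, hne x hx⟩))
  have hpos : ∀ x ∈ t, ∀ y, 0 ≤ y → 0 ≤ F x y := fun x hx =>
    hF0 x ⟨(ht x hx).1, hne x (ht x hx)⟩
  refine ⟨∑ x ∈ t, F x, fun y hy hy0 => ?_⟩
  have hn : 0 < ‖y‖ := norm_pos_iff.2 hy0
  have hmem : ‖y‖⁻¹ • y ∈ ({y : A | 0 ≤ y} ∩ Metric.sphere 0 1) := by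
    refine ⟨smul_nonneg (by positivity) hy, ?_⟩
    simp [norm_smul, hn.ne']
  obtain ⟨x, hx, hxy⟩ := Set.mem_iUnion₂.1 (hcov hmem)
  have hxy' : 0 < F x y := by
    have : 0 < ‖y‖⁻¹ * F x y := by simpa using hxy
    exact (mul_pos_iff_of_pos_left (by positivity)).1 this
  rw [sum_apply]
  exact Finset.sum_pos' (fun i hi => hpos i hi y hy) ⟨x, hx, hxy'⟩

/-- A positive element spanning an extreme ray of the positive cone is a positive multiple of a
minimal projection. -/
theorem exists_isMinimalProjection_of_extreme {x : A} (hx : 0 ≤ x) (hx0 : x ≠ 0)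
    (hext : ∀ y, 0 ≤ y → y ≤ x → ∃ r : ℝ, 0 ≤ r ∧ y = r • x) :
    ∃ (e : A) (r : ℝ), IsMinimalProjection e ∧ 0 ≤ r ∧ x = r • e := by
  set s := CFC.sqrt x with hs
  have hss : s * s = x := CFC.sqrt_mul_sqrt_self x hx
  have hsa : star s = s := (IsSelfAdjoint.of_nonneg (CFC.sqrt_nonneg x)).star_eq
  have hxa : star x = x := (IsSelfAdjoint.of_nonneg hx).star_eq
  -- Since `s a s ≤ ‖a‖ s² = ‖a‖ x`, extremality forces `s a s` onto the ray of `x`.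
  have key : ∀ a : A, 0 ≤ a → ∃ r : ℝ, 0 ≤ r ∧ s * a * s = r • x := by
    intro a ha
    have h1 : s * a * s ≤ ‖a‖ • x := by
      have := CStarAlgebra.star_left_conjugate_le_norm_smul (a := s) (b := a)
        (IsSelfAdjoint.of_nonneg ha)
      rwa [hsa, hss] at this
    have h0 : 0 ≤ s * a * s := by
      have := star_left_conjugate_nonneg ha s
      rwa [hsa] at this
    rcases eq_or_ne a 0 with rfl | hne
    · exact ⟨0, le_rfl, by simp⟩
    have hn : 0 < ‖a‖ := norm_pos_iff.2 hne
    obtain ⟨r, hr, h⟩ := hext (‖a‖⁻¹ • (s * a * s)) (smul_nonneg (by positivity) h0) (by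
      have := smul_le_smul_of_nonneg_left h1 (inv_nonneg.2 hn.le)
      rwa [inv_smul_smul₀ hn.ne'] at this)
    refine ⟨‖a‖ * r, by positivity, ?_⟩
    rw [mul_smul, ← h, smul_inv_smul₀ hn.ne']
  have keyC : ∀ a : A, ∃ c : ℂ, s * a * s = c • x := by
    intro a
    have ha : a ∈ Submodule.span ℂ {a : A | 0 ≤ a} := by
      rw [CStarAlgebra.span_nonneg]; trivial
    induction ha using Submodule.span_induction with
    | mem a ha =>
      obtain ⟨r, -, h⟩ := key a ha
      exact ⟨r, by rw [h, Complex.coe_smul]⟩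
    | zero => exact ⟨0, by simp⟩
    | add a b _ _ ha hb =>
      obtain ⟨c, hc⟩ := ha
      obtain ⟨d, hd⟩ := hb
      exact ⟨c + d, by rw [mul_add, add_mul, hc, hd, add_smul]⟩
    | smul k a _ ha =>
      obtain ⟨c, hc⟩ := ha
      exact ⟨k * c, by rw [mul_smul_comm, smul_mul_assoc, hc, mul_smul]⟩
  -- Taking `a = x` gives `x² = r x`, so `r⁻¹ x` is idempotent.
  obtain ⟨r, hr, hxx⟩ := key x hx
  have hsxs : s * x * s = x * x := by
    calc s * x * s = s * (s * s) * s := by rw [hss]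
      _ = (s * s) * (s * s) := by noncomm_ring
      _ = x * x := by rw [hss]
  have hxx : x * x = r • x := by rw [← hsxs, hxx]
  have hr0 : r ≠ 0 := by
    rintro rfl
    have : star x * x = 0 := by rw [hxa, hxx, zero_smul]
    exact hx0 (CStarRing.star_mul_self_eq_zero_iff x |>.1 this)
  refine ⟨r⁻¹ • x, r, ⟨?_, ?_, ?_, ?_⟩, hr, (smul_inv_smul₀ hr0 x).symm⟩
  · rw [star_smul, hxa]; simp
  · rw [smul_mul_smul_comm, hxx, smul_smul, mul_assoc, inv_mul_cancel₀ hr0, mul_one]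
  · exact smul_ne_zero (inv_ne_zero hr0) hx0
  · intro a
    obtain ⟨c, hc⟩ := keyC a
    have h : x * a * x = c • r • x := by
      calc x * a * x = (s * s) * a * (s * s) := by rw [hss]
        _ = s * (s * a * s) * s := by noncomm_ring
        _ = c • r • x := by rw [hc, mul_smul_comm, smul_mul_assoc, hsxs, hxx]
    refine ⟨c, ?_⟩
    rw [smul_mul_assoc, smul_mul_smul_comm, h, smul_comm c r x, smul_smul, mul_assoc,
      inv_mul_cancel₀ hr0, mul_one, smul_comm]

/-- A closed convex condition that is stable under nonnegative multiples and holds at the minimal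
projections holds on the positive cone. -/
theorem nonneg_of_forall_isMinimalProjection [FiniteDimensional ℂ A] (K : ProperCone ℝ A)
    (hK : ∀ e, IsMinimalProjection e → e ∈ K) {x : A} (hx : 0 ≤ x) : x ∈ K := by
  have : FiniteDimensional ℝ A := FiniteDimensional.complexToReal A
  have : ProperSpace A := FiniteDimensional.proper ℝ A
  rcases eq_or_ne x 0 with rfl | hx0
  · exact K.zero_mem
  obtain ⟨τ, hτ⟩ := exists_faithful_functional (A := A)
  have hτ0 : ∀ y, 0 ≤ y → 0 ≤ τ y := by
    intro y hy
    rcases eq_or_ne y 0 with rfl | h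
    · simp
    · exact (hτ y hy h).le
  -- A compact base of the positive cone: by Krein–Milman it is enough to treat its extreme points,
  -- which span extreme rays of the cone.
  let S : Set A := {y | 0 ≤ y ∧ τ y = 1}
  have hScl : IsClosed S :=
    CStarAlgebra.isClosed_nonneg.inter (isClosed_eq τ.continuous continuous_const)
  have hSconv : Convex ℝ S := by
    rintro y ⟨hy, hy1⟩ z ⟨hz, hz1⟩ a b ha hb hab
    refine ⟨add_nonneg (smul_nonneg ha hy) (smul_nonneg hb hz), ?_⟩
    simp [hy1, hz1, hab]
  have hScomp : IsCompact S := by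
    refine Metric.isCompact_of_isClosed_isBounded hScl ?_
    have hB : IsCompact ({y : A | 0 ≤ y} ∩ Metric.sphere 0 1) :=
      (isCompact_sphere (0 : A) 1).inter_left CStarAlgebra.isClosed_nonneg
    rcases ({y : A | 0 ≤ y} ∩ Metric.sphere 0 1).eq_empty_or_nonempty with he | hne
    · exfalso
      have : ‖x‖⁻¹ • x ∈ ({y : A | 0 ≤ y} ∩ Metric.sphere 0 1) :=
        ⟨smul_nonneg (by positivity) hx, by simp [norm_smul, hx0]⟩
      rw [he] at this
      exact this
    obtain ⟨m, ⟨hm, hm1⟩, hmin⟩ := hB.exists_isMinOn hne τ.continuous.continuousOn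
    have hm0 : m ≠ 0 := by
      rintro rfl
      simp at hm1
    have hmpos := hτ m hm hm0
    refine isBounded_iff_forall_norm_le.2 ⟨(τ m)⁻¹, fun y hy => ?_⟩
    rcases eq_or_ne y 0 with rfl | hy0
    · simpa using hmpos.le
    have hn : 0 < ‖y‖ := norm_pos_iff.2 hy0
    have h1 : τ m ≤ τ (‖y‖⁻¹ • y) :=
      hmin ⟨smul_nonneg (by positivity) hy.1, by simp [norm_smul, hn.ne']⟩
    rw [map_smul, hy.2, smul_eq_mul, mul_one] at h1
    exact (le_inv_comm₀ hmpos hn).1 h1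
  have hext : S.extremePoints ℝ ⊆ K := by
    rintro y ⟨⟨hy, hy1⟩, hyext⟩
    have hy0 : y ≠ 0 := by
      rintro rfl
      simp at hy1
    obtain ⟨e, r, he, hr, rfl⟩ := exists_isMinimalProjection_of_extreme hy hy0 (by
      intro z hz hzy
      refine ⟨τ z, hτ0 z hz, ?_⟩
      by_cases hz0 : z = 0
      · simp [hz0]
      by_cases hyz : y - z = 0
      · rw [sub_eq_zero] at hyz
        rw [← hyz, hy1, one_smul]
      have hz1 := hτ z hz hz0
      have hyz1 := hτ (y - z) (sub_nonneg.2 hzy) hyz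
      have hsum : τ z + τ (y - z) = 1 := by rw [map_sub, hy1]; ring
      -- With `0 ≤ z ≤ y` and `τ y = 1`, `y` is the convex combination, with weights `τ z` and `τ (y
      -- - z)`, of the normalisations of `z` and `y - z`.
      have h := hyext (x₁ := (τ z)⁻¹ • z) ⟨smul_nonneg (by positivity) hz, by
          rw [map_smul, smul_eq_mul, inv_mul_cancel₀ hz1.ne']⟩
        (x₂ := (τ (y - z))⁻¹ • (y - z)) ⟨smul_nonneg (by positivity) (sub_nonneg.2 hzy), by
          rw [map_smul, smul_eq_mul, inv_mul_cancel₀ hyz1.ne']⟩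
        ⟨τ z, τ (y - z), hz1, hyz1, hsum, by
          rw [smul_inv_smul₀ hz1.ne', smul_inv_smul₀ hyz1.ne', add_sub_cancel]⟩
      rw [← h, smul_inv_smul₀ hz1.ne'])
    exact K.smul_mem (hK e he) hr
  have hSK : S ⊆ K := by
    rw [← closure_convexHull_extremePoints hScomp hSconv]
    exact closure_minimal (convexHull_min hext K.convex) K.isClosed
  have hτx := hτ x hx hx0
  have hmem : (τ x)⁻¹ • x ∈ K := hSK ⟨smul_nonneg (by positivity) hx, by
    rw [map_smul, smul_eq_mul, inv_mul_cancel₀ hτx.ne']⟩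
  have := K.smul_mem hmem hτx.le
  rwa [smul_inv_smul₀ hτx.ne'] at this

end ProjectionCone

/-! ### Testing linear maps on minimal projections -/

section PositiveMaps

variable {A : Type*} [CStarAlgebra A] [PartialOrder A] [StarOrderedRing A]
  [FiniteDimensional ℂ A]
variable {H : Type*} [NormedAddCommGroup H] [InnerProductSpace ℂ H] [CompleteSpace H]

/-- Positivity can be tested on minimal projections. -/
theorem isPositive_of_forall_isMinimalProjection {θ : A →ₗ[ℂ] (H →L[ℂ] H)}
    (hθ : ∀ e, IsMinimalProjection e → 0 ≤ θ e) : IsPositive θ := by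
  have hcont : Continuous θ := θ.continuous_of_finiteDimensional
  let K : ProperCone ℝ A :=
    { carrier := {y | 0 ≤ θ y}
      add_mem' := fun {a b} ha hb => by
        simpa using add_nonneg (show 0 ≤ θ a from ha) (show 0 ≤ θ b from hb)
      zero_mem' := by simp
      smul_mem' := fun c a ha => by
        have h : θ ((c : ℝ) • a) = (c : ℝ) • θ a := by
          rw [← Complex.coe_smul, map_smul, Complex.coe_smul]
        change 0 ≤ θ ((c : ℝ) • a)
        rw [h]
        exact smul_nonneg c.2 ha
      isClosed' := CStarAlgebra.isClosed_nonneg.preimage hcont }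
  exact fun a ha => nonneg_of_forall_isMinimalProjection K hθ ha

omit [FiniteDimensional ℂ A] [CompleteSpace H] in
/-- A linear map vanishing on positive elements is zero. -/
theorem eq_zero_of_forall_nonneg {θ : A →ₗ[ℂ] (H →L[ℂ] H)} (h : ∀ a, 0 ≤ a → θ a = 0) :
    θ = 0 := by
  refine LinearMap.ext_on (s := {a : A | 0 ≤ a}) CStarAlgebra.span_nonneg ?_
  intro a ha
  simpa using h a ha

/-- A nonzero map does not vanish on some minimal projection. -/
theorem exists_isMinimalProjection_apply_ne_zero {θ : A →ₗ[ℂ] (H →L[ℂ] H)} (hθ : θ ≠ 0) :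
    ∃ e, IsMinimalProjection e ∧ θ e ≠ 0 := by
  by_contra! h
  have h1 : IsPositive θ := isPositive_of_forall_isMinimalProjection fun e he => (h e he).ge
  have h2 : IsPositive (-θ) := isPositive_of_forall_isMinimalProjection fun e he => by
    simp [h e he]
  refine hθ (eq_zero_of_forall_nonneg fun a ha => le_antisymm ?_ (h1 a ha))
  simpa using h2 a ha

end PositiveMaps
end PositiveMap

/-! ### Positive matrices, complete positivity and Cauchy–Schwarz -/

namespace PositiveMap

theorem exists_eq_star_mul_self_of_nonneg {C : Type*} [NonUnitalCStarAlgebra C] [PartialOrder C]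
    [StarOrderedRing C] {x : C} (hx : 0 ≤ x) : ∃ y, x = star y * y :=
  CStarAlgebra.nonneg_iff_eq_star_mul_self.1 hx

section CStarMatrix

variable {B : Type*} [CStarAlgebra B] [PartialOrder B] [StarOrderedRing B]

/-- The Gram matrix `(vᵢ* vⱼ)` is positive. -/
theorem gram_nonneg {k : ℕ} [NeZero k] (v : Fin k → B) :
    0 ≤ CStarMatrix.ofMatrix (Matrix.of fun i j : Fin k => star (v i) * v j) := by
  -- The matrix with first row `v` and zeros elsewhere; its `N* N` is the Gram matrix.
  let N : CStarMatrix (Fin k) (Fin k) B :=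
    CStarMatrix.ofMatrix (Matrix.of fun i j : Fin k => if i = 0 then v j else 0)
  have h : star N * N = CStarMatrix.ofMatrix (Matrix.of fun i j : Fin k => star (v i) * v j) := by
    ext i j
    rw [CStarMatrix.mul_apply, Finset.sum_eq_single 0]
    · simp [N, CStarMatrix.star_apply]
    · intro b _ hb
      simp [N, CStarMatrix.star_apply, hb]
    · simp
  rw [← h]
  exact star_mul_self_nonneg N

theorem diag_nonneg_of_nonneg {k : ℕ} {M : CStarMatrix (Fin k) (Fin k) B} (hM : 0 ≤ M)
    (i : Fin k) : 0 ≤ M i i := by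
  obtain ⟨N, rfl⟩ := exists_eq_star_mul_self_of_nonneg hM
  rw [CStarMatrix.mul_apply]
  exact Finset.sum_nonneg fun j _ => by
    rw [CStarMatrix.star_apply]
    exact star_mul_self_nonneg _

end CStarMatrix

section

variable {H : Type*} [NormedAddCommGroup H] [InnerProductSpace ℂ H] [CompleteSpace H]

/-- The quadratic form of a positive operator matrix is nonnegative. -/
theorem re_sum_inner_nonneg {k : ℕ} {M : CStarMatrix (Fin k) (Fin k) (H →L[ℂ] H)} (hM : 0 ≤ M)
    (ξ : Fin k → H) : 0 ≤ (∑ i, ∑ j, inner ℂ (ξ i) (M i j (ξ j))).re := by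
  obtain ⟨N, rfl⟩ := exists_eq_star_mul_self_of_nonneg hM
  have h : ∑ i, ∑ j, inner ℂ (ξ i) ((star N * N) i j (ξ j)) =
      ∑ l, inner ℂ (∑ i, N l i (ξ i)) (∑ j, N l j (ξ j)) := by
    have h1 : ∀ i j, inner ℂ (ξ i) ((star N * N) i j (ξ j)) =
        ∑ l, inner ℂ (N l i (ξ i)) (N l j (ξ j)) := by
      intro i j
      simp only [CStarMatrix.mul_apply, CStarMatrix.star_apply, sum_apply,
        mul_apply_eq_comp, inner_sum, ContinuousLinearMap.star_eq_adjoint,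
        ContinuousLinearMap.adjoint_inner_right]
    simp only [h1, inner_sum, sum_inner]
    calc _ = ∑ i, ∑ l, ∑ j, inner ℂ (N l i (ξ i)) (N l j (ξ j)) :=
          Finset.sum_congr rfl fun i _ => Finset.sum_comm
      _ = ∑ l, ∑ i, ∑ j, inner ℂ (N l i (ξ i)) (N l j (ξ j)) := Finset.sum_comm
      _ = _ := Finset.sum_congr rfl fun l _ => Finset.sum_comm
  rw [h, Complex.re_sum]
  exact Finset.sum_nonneg fun l _ => inner_self_nonneg (𝕜 := ℂ)

variable {A : Type*} [CStarAlgebra A] [PartialOrder A] [StarOrderedRing A]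

theorem IsKPositive.isPositive {k : ℕ} [NeZero k] {φ : A →ₗ[ℂ] (H →L[ℂ] H)}
    (hφ : IsKPositive k φ) : IsPositive φ := by
  intro a ha
  obtain ⟨b, rfl⟩ := exists_eq_star_mul_self_of_nonneg ha
  have h := diag_nonneg_of_nonneg (hφ _ (gram_nonneg fun _ : Fin k => b)) 0
  simpa using h

theorem IsCompletelyPositive.isPositive {φ : A →ₗ[ℂ] (H →L[ℂ] H)}
    (hφ : IsCompletelyPositive φ) : IsPositive φ :=
  (hφ 1).isPositive

theorem IsKPositive.add {k : ℕ} {φ ψ : A →ₗ[ℂ] (H →L[ℂ] H)}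
    (hφ : IsKPositive k φ) (hψ : IsKPositive k ψ) : IsKPositive k (φ + ψ) := fun M hM =>
  add_nonneg (hφ M hM) (hψ M hM)

theorem IsCompletelyPositive.add {φ ψ : A →ₗ[ℂ] (H →L[ℂ] H)}
    (hφ : IsCompletelyPositive φ) (hψ : IsCompletelyPositive ψ) : IsCompletelyPositive (φ + ψ) :=
  fun k => (hφ k).add (hψ k)

theorem isCompletelyPositive_zero : IsCompletelyPositive (0 : A →ₗ[ℂ] (H →L[ℂ] H)) :=
  fun _ _ _ => le_refl _

/-- A Kraus-type criterion for complete positivity. -/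
theorem isCompletelyPositive_of_sum {σ : Type*} [Fintype σ] {ψ : A →ₗ[ℂ] (H →L[ℂ] H)}
    (T : σ → A →ₗ[ℂ] (H →L[ℂ] H))
    (h : ∀ x y, ψ (star x * y) = ∑ l, star (T l x) * T l y) : IsCompletelyPositive ψ := by
  intro k M hM
  obtain ⟨N, rfl⟩ := exists_eq_star_mul_self_of_nonneg hM
  have h : (star N * N).map ψ = ∑ l, star (N.map (T l)) * N.map (T l) := by
    ext1 i j
    have h2 : ∀ F : σ → CStarMatrix (Fin k) (Fin k) (H →L[ℂ] H),
        (∑ l, F l) i j = ∑ l, F l i j := fun F =>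
      Matrix.sum_apply i j Finset.univ F
    rw [h2]
    simp only [CStarMatrix.map_apply, CStarMatrix.mul_apply, map_sum, CStarMatrix.star_apply, h]
    rw [Finset.sum_comm]
  rw [h]
  exact Finset.sum_nonneg fun l _ => star_mul_self_nonneg _

/-- A Cauchy–Schwarz inequality for `2`-positive maps. -/
theorem IsKPositive.norm_inner_sq_le {φ : A →ₗ[ℂ] (H →L[ℂ] H)} (hφ : IsKPositive 2 φ) {a b : A}
    (ξ η : H) (hη : inner ℂ η (φ (star a * a) η) = 1) :
    ‖inner ℂ η (φ (star a * b) ξ)‖ ^ 2 ≤ (inner ℂ ξ (φ (star b * b) ξ)).re := by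
  set z := inner ℂ η (φ (star a * b) ξ) with hz
  -- The coefficient `-z` minimises the quadratic form along `η`; as `⟨η, φ(a* a)η⟩ = 1`, the form
  -- becomes `⟨ξ, φ(b* b)ξ⟩ - |z|²`.
  have h := re_sum_inner_nonneg (hφ _ (gram_nonneg ![a, b])) ![-z • η, ξ]
  have h' : inner ℂ ξ (φ (star b * a) η) = starRingEnd ℂ z := by
    have hp := hφ _ (gram_nonneg ![a, b])
    have hs := (IsSelfAdjoint.of_nonneg hp).star_eq
    have := congrFun (congrFun hs 1) 0
    simp [CStarMatrix.star_apply] at this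
    rw [← this, ContinuousLinearMap.star_eq_adjoint, ContinuousLinearMap.adjoint_inner_right, hz,
      inner_conj_symm]
  simp [Fin.sum_univ_two, inner_smul_left, inner_smul_right, hη, h', ← hz] at h
  rw [← Complex.normSq_eq_norm_sq, Complex.normSq_apply]
  linarith

end
end PositiveMap

/-! ### The left ideal of a minimal projection as a Hilbert space -/

namespace PositiveMap

section Frame

variable {A : Type*} [CStarAlgebra A]

/-- The functional `ω` with `e a e = ω(a) e` attached to a minimal projection `e`. -/
noncomputable def IsMinimalProjection.state {e : A} (he : IsMinimalProjection e) : A →ₗ[ℂ] ℂ where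
  toFun a := (he.corner a).choose
  map_add' a b := he.smul_inj <| by
    rw [← (he.corner (a + b)).choose_spec, add_smul, ← (he.corner a).choose_spec,
      ← (he.corner b).choose_spec, mul_add, add_mul]
  map_smul' c a := he.smul_inj <| by
    rw [← (he.corner (c • a)).choose_spec, RingHom.id_apply, smul_assoc,
      ← (he.corner a).choose_spec, mul_smul_comm, smul_mul_assoc]

theorem IsMinimalProjection.mul_mul_self {e : A} (he : IsMinimalProjection e) (a : A) :
    e * a * e = he.state a • e :=
  (he.corner a).choose_spec

theorem IsMinimalProjection.state_star {e : A} (he : IsMinimalProjection e) (a : A) :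
    he.state (star a) = starRingEnd ℂ (he.state a) := by
  apply he.smul_inj
  have h := congrArg star (he.mul_mul_self a)
  simp only [star_mul, star_smul, he.isSelfAdjoint, ← mul_assoc] at h
  rw [← he.mul_mul_self, h]
  rfl

theorem IsMinimalProjection.state_mul_self {e : A} (he : IsMinimalProjection e) (a : A) :
    he.state (a * e) = he.state a := by
  apply he.smul_inj
  rw [← he.mul_mul_self, ← he.mul_mul_self, mul_assoc, mul_assoc, he.mul_self, ← mul_assoc]

/-- A family in `A e` that is orthonormal for the inner product `x, y ↦ x* y ∈ e A e = ℂ e`. -/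
def IsOrthonormalFrame {n : ℕ} (e : A) (k : Fin n → A) : Prop :=
  (∀ l, k l * e = k l) ∧ ∀ l m, star (k l) * k m = if l = m then e else 0

/-- Multiplying a relation by `star (k m)` isolates its `m`-th coefficient. This bounds the length
of a frame by the dimension of `A`. -/
theorem IsOrthonormalFrame.linearIndependent {n : ℕ} {e : A} {k : Fin n → A}
    (he : IsMinimalProjection e) (hk : IsOrthonormalFrame e k) : LinearIndependent ℂ k := by
  rw [Fintype.linearIndependent_iff]
  intro c hc m
  have h := congrArg (star (k m) * ·) hc
  simp only [Finset.mul_sum, mul_smul_comm, hk.2, mul_zero, smul_ite, smul_zero,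
    Finset.sum_ite_eq, Finset.mem_univ, if_true] at h
  exact (smul_eq_zero.1 h).resolve_right he.ne_zero

/-- The left ideal `A e` of a minimal projection has an orthonormal basis. -/
theorem IsMinimalProjection.exists_orthonormalFrame [PartialOrder A] [StarOrderedRing A]
    [FiniteDimensional ℂ A] {e : A} (he : IsMinimalProjection e) :
    ∃ (n : ℕ) (k : Fin n → A), IsOrthonormalFrame e k ∧
      ∀ a, a * e = ∑ l, he.state (star (k l) * a) • k l := by
  let S : Set ℕ := {n | ∃ k : Fin n → A, IsOrthonormalFrame e k}
  have hS0 : S.Nonempty := ⟨0, Fin.elim0, fun l => l.elim0, fun l => l.elim0⟩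
  have hSb : BddAbove S := by
    refine ⟨Module.finrank ℂ A, ?_⟩
    rintro n ⟨k, hk⟩
    simpa using (hk.linearIndependent he).fintype_card_le_finrank
  obtain ⟨n, hn⟩ : ∃ n, n = sSup S := ⟨_, rfl⟩
  obtain ⟨k, hk⟩ : n ∈ S := hn ▸ Nat.sSup_mem hS0 hSb
  refine ⟨n, k, hk, fun a => ?_⟩
  have hek : ∀ l, e * star (k l) = star (k l) := by
    intro l
    have := congrArg star (hk.1 l)
    rwa [star_mul, he.isSelfAdjoint] at this
  -- The frame has maximal length. A nonzero Gram–Schmidt residual `r` satisfies `r* r ∈ eAe = ℂe`,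
  -- so it can be normalised and appended, a contradiction.
  set r := a * e - ∑ l, he.state (star (k l) * a) • k l with hr
  by_contra hne
  have hr0 : r ≠ 0 := fun h => hne (sub_eq_zero.1 h)
  have hre : r * e = r := by
    rw [hr, sub_mul, mul_assoc, he.mul_self, Finset.sum_mul]
    simp only [smul_mul_assoc, hk.1]
  have her : e * star r = star r := by
    have := congrArg star hre
    rwa [star_mul, he.isSelfAdjoint] at this
  have hkr : ∀ l, star (k l) * r = 0 := by
    intro l
    rw [hr, mul_sub, Finset.mul_sum]
    simp only [mul_smul_comm, hk.2, smul_ite, smul_zero, Finset.sum_ite_eq, Finset.mem_univ,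
      if_true]
    rw [← he.mul_mul_self, ← mul_assoc, ← mul_assoc, hek, sub_self]
  have hrr : star r * r = he.state (star r * r) • e := by
    rw [← he.mul_mul_self, ← mul_assoc, her, mul_assoc, hre]
  obtain ⟨c, hc0, hc⟩ := he.exists_real_of_smul_nonneg (hrr ▸ star_mul_self_nonneg r)
  rw [hc, Complex.coe_smul] at hrr
  have hcne : c ≠ 0 := by
    rintro rfl
    rw [zero_smul] at hrr
    exact hr0 (CStarRing.star_mul_self_eq_zero_iff r |>.1 hrr)
  set s := (Real.sqrt c)⁻¹ • r with hs
  have hsk : ∀ l, star (k l) * s = 0 := fun l => by rw [hs, mul_smul_comm, hkr, smul_zero]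
  have hks : ∀ l, star s * k l = 0 := fun l => by
    have := congrArg star (hsk l)
    rwa [star_mul, star_star, star_zero] at this
  have hss : star s * s = e := by
    rw [hs, star_smul, smul_mul_smul_comm, hrr, smul_smul]
    have h1 : Real.sqrt c * Real.sqrt c = c := Real.mul_self_sqrt hc0
    have h2 : star (Real.sqrt c)⁻¹ * (Real.sqrt c)⁻¹ * c = 1 := by
      rw [star_trivial, ← mul_inv, h1, inv_mul_cancel₀ hcne]
    rw [h2, one_smul]
  have hmem : n + 1 ∈ S := by
    refine ⟨Fin.snoc k s, ?_, ?_⟩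
    · intro l
      refine Fin.lastCases ?_ (fun l => ?_) l
      · rw [Fin.snoc_last, hs, smul_mul_assoc, hre]
      · rw [Fin.snoc_castSucc, hk.1]
    · intro l m
      refine Fin.lastCases ?_ (fun l => ?_) l <;> refine Fin.lastCases ?_ (fun m => ?_) m
      · simp [hss]
      · simp [hks, (Fin.castSucc_lt_last m).ne']
      · simp [hsk, (Fin.castSucc_lt_last l).ne]
      · simp [hk.2]
  have := le_csSup hSb hmem
  omega

end Frame

/-! ### A completely positive map below a 2-positive map -/

section

variable {A : Type*} [CStarAlgebra A] [PartialOrder A] [StarOrderedRing A]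
  [FiniteDimensional ℂ A]
variable {H : Type*} [NormedAddCommGroup H] [InnerProductSpace ℂ H] [CompleteSpace H]

/-- A nonzero positive operator has a vector at which its quadratic form is `1`. -/
theorem exists_inner_eq_one {T : H →L[ℂ] H} (hT : 0 ≤ T) (hT0 : T ≠ 0) :
    ∃ η, inner ℂ η (T η) = 1 := by
  obtain ⟨S, rfl⟩ := exists_eq_star_mul_self_of_nonneg hT
  have hS : S ≠ 0 := by
    rintro rfl
    simp at hT0
  obtain ⟨η, hη⟩ : ∃ η, S η ≠ 0 := by
    by_contra! h
    exact hS (ContinuousLinearMap.ext fun x => by simpa using h x)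
  have hn : ‖S η‖ ≠ 0 := norm_ne_zero_iff.2 hη
  refine ⟨((‖S η‖⁻¹ : ℝ) : ℂ) • η, ?_⟩
  rw [mul_apply_eq_comp, ContinuousLinearMap.star_eq_adjoint,
    ContinuousLinearMap.adjoint_inner_right, map_smul, inner_smul_left, inner_smul_right,
    inner_self_eq_norm_sq_to_K]
  have hn' : (‖S η‖ : ℂ) ≠ 0 := by exact_mod_cast hn
  simp
  field_simp

/-- A nonzero `2`-positive map majorizes a nonzero completely positive map. -/
theorem IsKPositive.exists_completelyPositive_le {φ : A →ₗ[ℂ] (H →L[ℂ] H)}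
    (hφ : IsKPositive 2 φ) (hφ0 : φ ≠ 0) :
    ∃ ψ : A →ₗ[ℂ] (H →L[ℂ] H), IsCompletelyPositive ψ ∧ Majorizes φ ψ ∧ ψ ≠ 0 := by
  have hpos : IsPositive φ := hφ.isPositive
  obtain ⟨e, he, hφe⟩ := exists_isMinimalProjection_apply_ne_zero hφ0
  obtain ⟨η, hη⟩ := exists_inner_eq_one (hpos e he.nonneg) hφe
  obtain ⟨n, k, hk, hframe⟩ := he.exists_orthonormalFrame
  have hη0 : η ≠ 0 := by
    rintro rfl
    simp at hη
  have hηn : ‖η‖ ≠ 0 := norm_ne_zero_iff.2 hη0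
  -- Scaled so that `‖R ξ‖ = |⟨η, ξ⟩|`: the functional `⟨η, ·⟩` is encoded as an operator on `H`.
  set R : H →L[ℂ] H := ((‖η‖⁻¹ : ℝ) : ℂ) • InnerProductSpace.rankOne ℂ η η with hR
  have hRapply : ∀ ξ, ‖R ξ‖ = ‖inner ℂ η ξ‖ := by
    intro ξ
    rw [hR, smul_apply, InnerProductSpace.rankOne_apply, norm_smul, norm_smul]
    simp
    field_simp
  set ω := he.state with hω
  let S : Fin n → H →L[ℂ] H := fun m => R * φ (star (k m))
  let T : Fin n → A →ₗ[ℂ] (H →L[ℂ] H) := fun l =>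
    ∑ m, (ω ∘ₗ LinearMap.mulLeft ℂ (star (k l)) ∘ₗ LinearMap.mulRight ℂ (k m)).smulRight (S m)
  -- This is `V* (π(a) ⊗ 1) V`, with `π` left multiplication on `Ae` and `V ξ = ∑ k m ⊗ S m ξ`. The
  -- `T l a` are the components of `(π(a) ⊗ 1) V` in the frame, so they serve as Kraus operators.
  let ψ : A →ₗ[ℂ] (H →L[ℂ] H) := ∑ m', ∑ m,
    (ω ∘ₗ LinearMap.mulLeft ℂ (star (k m')) ∘ₗ LinearMap.mulRight ℂ (k m)).smulRight
      (star (S m') * S m)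
  have hT : ∀ l a, T l a = ∑ m, ω (star (k l) * (a * k m)) • S m := by
    intro l a
    simp [T, LinearMap.sum_apply]
  have hψ : ∀ a, ψ a = ∑ m', ∑ m, ω (star (k m') * (a * k m)) • (star (S m') * S m) := by
    intro a
    simp [ψ, LinearMap.sum_apply]
  -- Parseval's identity in `A e`
  have hpars : ∀ a b : A, ω (star a * b) =
      ∑ l, starRingEnd ℂ (ω (star (k l) * a)) * ω (star (k l) * b) := by
    intro a b
    rw [hω, ← he.state_mul_self, mul_assoc, hframe b, Finset.mul_sum, map_sum]
    refine Finset.sum_congr rfl fun l _ => ?_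
    rw [mul_smul_comm, map_smul, smul_eq_mul, mul_comm, ← he.state_star, star_mul, star_star]
  -- on `b* b` with `e b = b`, `ψ` is given by one rank one Kraus operator
  have hrank : ∀ b : A, e * b = b → ψ (star b * b) = star (R * φ b) * (R * φ b) := by
    intro b hb
    have hbe : star b * e = star b := by
      have := congrArg star hb
      rwa [star_mul, he.isSelfAdjoint] at this
    have hsum : b = ∑ m, ω (b * k m) • star (k m) := by
      have h1 := hframe (star b)
      rw [hbe] at h1
      have h2 := congrArg star h1
      rw [star_star, star_sum] at h2
      refine h2.trans (Finset.sum_congr rfl fun m _ => ?_)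
      have := he.state_star (b * k m)
      rw [star_mul] at this
      rw [star_smul, hω, this]
      simp
    have hX : R * φ b = ∑ m, ω (b * k m) • S m := by
      conv_lhs => rw [hsum]
      rw [map_sum, Finset.mul_sum]
      refine Finset.sum_congr rfl fun m _ => ?_
      rw [map_smul, mul_smul_comm]
    rw [hX, hψ, star_sum, Finset.sum_mul]
    refine Finset.sum_congr rfl fun m' _ => ?_
    rw [Finset.mul_sum]
    refine Finset.sum_congr rfl fun m _ => ?_
    rw [star_smul, smul_mul_smul_comm]
    congr 1
    apply he.smul_inj
    have h3 : e * (b * k m) * e = b * k m := by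
      rw [← mul_assoc, hb, mul_assoc, hk.1]
    have h4 : b * k m = ω (b * k m) • e := by rw [hω, ← he.mul_mul_self, h3]
    have h5 : star (k m') * star b = star (ω (b * k m')) • e := by
      have h3' : e * (b * k m') * e = b * k m' := by
        rw [← mul_assoc, hb, mul_assoc, hk.1]
      rw [← star_mul, ← he.isSelfAdjoint, ← star_smul, hω, ← he.mul_mul_self, h3']
    have h6 : star (k m') * (star b * b * k m) =
        (star (ω (b * k m')) * ω (b * k m)) • e := by
      calc _ = (star (k m') * star b) * (b * k m) := by noncomm_ring
        _ = (star (ω (b * k m')) • e) * (ω (b * k m) • e) := by rw [h5, ← h4]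
        _ = _ := by rw [smul_mul_smul_comm, he.mul_self]
    rw [hω, ← he.mul_mul_self, h6, mul_smul_comm, he.mul_self, smul_mul_assoc, he.mul_self]
  refine ⟨ψ, isCompletelyPositive_of_sum T fun x y => ?_, ?_, ?_⟩
  · rw [hψ]
    simp only [hT, star_sum, Finset.sum_mul_sum, star_smul, smul_mul_smul_comm]
    symm
    calc _ = ∑ m', ∑ l, ∑ m, (star (ω (star (k l) * (x * k m'))) * ω (star (k l) * (y * k m))) •
            (star (S m') * S m) := Finset.sum_comm
      _ = ∑ m', ∑ m, ∑ l, (star (ω (star (k l) * (x * k m'))) * ω (star (k l) * (y * k m))) •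
            (star (S m') * S m) := Finset.sum_congr rfl fun m' _ => Finset.sum_comm
      _ = _ := by
        refine Finset.sum_congr rfl fun m' _ => Finset.sum_congr rfl fun m _ => ?_
        rw [← Finset.sum_smul]
        congr 1
        have := hpars (x * k m') (y * k m)
        rw [star_mul] at this
        rw [show star (k m') * (star x * y * k m) = star (k m') * star x * (y * k m) by
          noncomm_ring, this]
        rfl
  · refine isPositive_of_forall_isMinimalProjection fun f hf => ?_
    rw [LinearMap.sub_apply, sub_nonneg]
    -- If `eAf = 0`, then `ψ f = 0`. Otherwise a nonzero `y ∈ eAf` has `y* y` a positive multiple of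
    -- `f`, which reduces the claim to `y* y` with `y ∈ eA`.
    by_cases hzero : ∀ a, e * a * f = 0
    · have h0 : ψ f = 0 := by
        rw [hψ]
        refine Finset.sum_eq_zero fun m' _ => Finset.sum_eq_zero fun m _ => ?_
        have : star (k m') * (f * k m) = 0 := by
          have h1 : star (k m') * f = 0 := by
            rw [← hzero (star (k m'))]
            have := congrArg star (hk.1 m')
            rw [star_mul, he.isSelfAdjoint] at this
            rw [this]
          rw [← mul_assoc, h1, zero_mul]
        rw [this, map_zero, zero_smul]
      rw [h0]
      exact hpos f hf.nonneg
    push Not at hzero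
    obtain ⟨a, ha⟩ := hzero
    set y := e * a * f with hy
    have hyf : y * f = y := by rw [hy, mul_assoc, hf.mul_self]
    have hey : e * y = y := by rw [hy, ← mul_assoc, ← mul_assoc, he.mul_self]
    have hfy : f * star y = star y := by
      have := congrArg star hyf
      rwa [star_mul, hf.isSelfAdjoint] at this
    have hyy : star y * y = hf.state (star y * y) • f := by
      rw [← hf.mul_mul_self, ← mul_assoc f, hfy, mul_assoc (star y), hyf]
    obtain ⟨c, hc0, hc⟩ := hf.exists_real_of_smul_nonneg (hyy ▸ star_mul_self_nonneg y)
    rw [hc] at hyy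
    have hcne : (c : ℂ) ≠ 0 := by
      intro h
      rw [h, zero_smul] at hyy
      exact ha (CStarRing.star_mul_self_eq_zero_iff y |>.1 hyy)
    have hmain : ψ (star y * y) ≤ φ (star y * y) := by
      rw [hrank y hey, ContinuousLinearMap.le_def, ContinuousLinearMap.isPositive_def']
      refine ⟨((IsSelfAdjoint.of_nonneg (hpos _ (star_mul_self_nonneg y))).sub
        (IsSelfAdjoint.star_mul_self _)), fun ξ => ?_⟩
      -- The only use of 2-positivity beyond positivity; `e* y = y` turns the mixed term into `⟨η,
      -- φ(y)ξ⟩`.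
      have hcs := hφ.norm_inner_sq_le (a := e) (b := y) ξ η (by rwa [he.isSelfAdjoint, he.mul_self])
      rw [he.isSelfAdjoint, hey, ← hRapply] at hcs
      rw [ContinuousLinearMap.reApplyInnerSelf_apply, sub_apply,
        inner_sub_left, map_sub, mul_apply_eq_comp, ContinuousLinearMap.star_eq_adjoint,
        ContinuousLinearMap.adjoint_inner_left, inner_self_eq_norm_sq, mul_apply_eq_comp,
        sub_nonneg, ← inner_conj_symm, RCLike.conj_re]
      exact hcs
    rw [hyy, map_smul, map_smul, Complex.coe_smul, Complex.coe_smul] at hmain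
    have hcpos : 0 < c := lt_of_le_of_ne hc0 fun h => hcne (by rw [← h]; rfl)
    have := smul_le_smul_of_nonneg_left hmain (inv_nonneg.2 hc0)
    rwa [inv_smul_smul₀ hcpos.ne', inv_smul_smul₀ hcpos.ne'] at this
  -- `ψ e = 0` would give `R φ(e) = 0`, but `‖R φ(e) η‖ = |⟨η, φ(e)η⟩| = 1`.
  · intro h0
    have h1 := hrank e he.mul_self
    rw [h0, LinearMap.zero_apply] at h1
    have h2 : R * φ e = 0 := (CStarRing.star_mul_self_eq_zero_iff _).1 h1.symm
    have h3 := hRapply (φ e η)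
    rw [← mul_apply_eq_comp, h2, hη] at h3
    simp at h3

end
end PositiveMap

/-! ### The transpose map -/

namespace PositiveMap

section Transpose

variable {H : Type*} [NormedAddCommGroup H] [InnerProductSpace ℂ H]
  [FiniteDimensional ℂ H] {ι : Type*} [Fintype ι] [DecidableEq ι]

theorem toMatrix_transposeMap (b : OrthonormalBasis ι ℂ H) (x : H →L[ℂ] H) :
    LinearMap.toMatrix b.toBasis b.toBasis (transposeMap b x : H →ₗ[ℂ] H) =
      (LinearMap.toMatrix b.toBasis b.toBasis (x : H →ₗ[ℂ] H)).transpose := by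
  simp [transposeMap]

omit [FiniteDimensional ℂ H] in
theorem toMatrix_injective (b : OrthonormalBasis ι ℂ H) {x y : H →L[ℂ] H}
    (h : LinearMap.toMatrix b.toBasis b.toBasis (x : H →ₗ[ℂ] H) =
      LinearMap.toMatrix b.toBasis b.toBasis (y : H →ₗ[ℂ] H)) : x = y :=
  ContinuousLinearMap.coe_injective ((LinearMap.toMatrix b.toBasis b.toBasis).injective h)

theorem transposeMap_transposeMap (b : OrthonormalBasis ι ℂ H) (x : H →L[ℂ] H) :
    transposeMap b (transposeMap b x) = x :=
  toMatrix_injective b <| by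
    rw [toMatrix_transposeMap, toMatrix_transposeMap, Matrix.transpose_transpose]

theorem transposeMap_comp_transposeMap_comp {A : Type*} [AddCommGroup A] [Module ℂ A]
    (b : OrthonormalBasis ι ℂ H) (φ : A →ₗ[ℂ] (H →L[ℂ] H)) :
    transposeMap b ∘ₗ transposeMap b ∘ₗ φ = φ :=
  LinearMap.ext fun a => transposeMap_transposeMap b (φ a)

theorem transposeMap_mul (b : OrthonormalBasis ι ℂ H) (x y : H →L[ℂ] H) :
    transposeMap b (x * y) = transposeMap b y * transposeMap b x :=
  toMatrix_injective b <| by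
    have h : ∀ u v : H →L[ℂ] H, ((u * v : H →L[ℂ] H) : H →ₗ[ℂ] H) =
        (u : H →ₗ[ℂ] H) ∘ₗ (v : H →ₗ[ℂ] H) := fun _ _ => rfl
    rw [toMatrix_transposeMap, h, h, LinearMap.toMatrix_comp _ b.toBasis,
      LinearMap.toMatrix_comp _ b.toBasis, toMatrix_transposeMap, toMatrix_transposeMap,
      Matrix.transpose_mul]

theorem transposeMap_star [CompleteSpace H] (b : OrthonormalBasis ι ℂ H) (x : H →L[ℂ] H) :
    transposeMap b (star x) = star (transposeMap b x) :=
  toMatrix_injective b <| by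
    have h : ∀ u : H →L[ℂ] H, ((star u : H →L[ℂ] H) : H →ₗ[ℂ] H) =
        LinearMap.adjoint (u : H →ₗ[ℂ] H) := by
      intro u
      rw [LinearMap.eq_adjoint_iff]
      intro v w
      exact ContinuousLinearMap.adjoint_inner_left u w v
    rw [toMatrix_transposeMap, h, h, LinearMap.toMatrix_adjoint, LinearMap.toMatrix_adjoint,
      toMatrix_transposeMap]
    rfl

/-- The transpose is a star-preserving anti-automorphism, so `y* y` goes to `t(y) t(y)*`. -/
theorem transposeMap_nonneg [CompleteSpace H] (b : OrthonormalBasis ι ℂ H) {x : H →L[ℂ] H}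
    (hx : 0 ≤ x) : 0 ≤ transposeMap b x := by
  obtain ⟨y, rfl⟩ := exists_eq_star_mul_self_of_nonneg hx
  rw [transposeMap_mul, transposeMap_star]
  exact mul_star_self_nonneg _

end Transpose

/-! ### Norm bounds from majorization -/

section

variable {A : Type*} [CStarAlgebra A] [PartialOrder A] [StarOrderedRing A]
variable {H : Type*} [NormedAddCommGroup H] [InnerProductSpace ℂ H] [CompleteSpace H]

omit [StarOrderedRing A] in
theorem IsPositive.add {φ ψ : A →ₗ[ℂ] (H →L[ℂ] H)} (hφ : IsPositive φ) (hψ : IsPositive ψ) :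
    IsPositive (φ + ψ) := fun a ha => add_nonneg (hφ a ha) (hψ a ha)

/-- A positive map vanishing at the unit is zero. -/
theorem IsPositive.eq_zero_of_apply_one {φ : A →ₗ[ℂ] (H →L[ℂ] H)} (hφ : IsPositive φ)
    (h : φ 1 = 0) : φ = 0 := by
  refine eq_zero_of_forall_nonneg fun a ha => le_antisymm ?_ (hφ a ha)
  have h1 : a ≤ algebraMap ℝ A ‖a‖ := (IsSelfAdjoint.of_nonneg ha).le_algebraMap_norm_self
  have h2 := hφ _ (sub_nonneg.2 h1)
  rw [Algebra.algebraMap_eq_smul_one, ← Complex.coe_smul, map_sub, map_smul, h, smul_zero,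
    zero_sub] at h2
  exact neg_nonneg.1 h2

/-- The norm is monotone on positive operators, and `a` is a combination of four positive elements
of norm at most `‖a‖`; hence the factor 4. This supplies boundedness in the compactness argument. -/
theorem norm_apply_le_of_majorizes {Φ : A →L[ℂ] (H →L[ℂ] H)} {ψ : A →ₗ[ℂ] (H →L[ℂ] H)}
    (hψ : IsPositive ψ) (h : Majorizes (Φ : A →ₗ[ℂ] (H →L[ℂ] H)) ψ) (a : A) :
    ‖ψ a‖ ≤ 4 * ‖Φ‖ * ‖a‖ := by
  obtain ⟨x, hx0, hx, ha⟩ := CStarAlgebra.exists_sum_four_nonneg a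
  have hb : ∀ i, ‖ψ (x i)‖ ≤ ‖Φ‖ * ‖a‖ := fun i =>
    calc ‖ψ (x i)‖ ≤ ‖Φ (x i)‖ := CStarAlgebra.norm_le_norm_of_nonneg_of_le (hψ _ (hx0 i))
          (sub_nonneg.1 (h _ (hx0 i)))
      _ ≤ ‖Φ‖ * ‖x i‖ := Φ.le_opNorm _
      _ ≤ ‖Φ‖ * ‖a‖ := by gcongr; exact hx i
  calc ‖ψ a‖ = ‖∑ i : Fin 4, Complex.I ^ (i : ℕ) • ψ (x i)‖ := by
        conv_lhs => rw [ha]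
        simp
    _ ≤ ∑ i : Fin 4, ‖Complex.I ^ (i : ℕ) • ψ (x i)‖ := norm_sum_le _ _
    _ ≤ ∑ _i : Fin 4, ‖Φ‖ * ‖a‖ := Finset.sum_le_sum fun i _ => by
        simpa [norm_smul] using hb i
    _ = 4 * ‖Φ‖ * ‖a‖ := by simp; ring

end

/-! ### Co-positive maps, atomicity and maximal decomposable maps -/

section

variable {A : Type*} [CStarAlgebra A] [PartialOrder A] [StarOrderedRing A]
  [FiniteDimensional ℂ A]
variable {H : Type*} [NormedAddCommGroup H] [InnerProductSpace ℂ H] [FiniteDimensional ℂ H]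
  [CompleteSpace H]
variable {ι : Type*} [Fintype ι] [DecidableEq ι]

omit [FiniteDimensional ℂ A] in
theorem IsKCopositive.isPositive {b : OrthonormalBasis ι ℂ H} {k : ℕ} [NeZero k]
    {φ : A →ₗ[ℂ] (H →L[ℂ] H)} (hφ : IsKCopositive b k φ) : IsPositive φ := fun a ha => by
  have h := transposeMap_nonneg b (IsKPositive.isPositive hφ a ha)
  rwa [LinearMap.comp_apply, transposeMap_transposeMap] at h

omit [FiniteDimensional ℂ A] in
theorem IsCopositive.isPositive {b : OrthonormalBasis ι ℂ H} {φ : A →ₗ[ℂ] (H →L[ℂ] H)}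
    (hφ : IsCopositive b φ) : IsPositive φ :=
  IsKCopositive.isPositive (hφ 1 : IsKCopositive b 1 φ)

omit [FiniteDimensional ℂ A] in
theorem IsCopositive.add {b : OrthonormalBasis ι ℂ H} {φ ψ : A →ₗ[ℂ] (H →L[ℂ] H)}
    (hφ : IsCopositive b φ) (hψ : IsCopositive b ψ) : IsCopositive b (φ + ψ) := by
  rw [IsCopositive, LinearMap.comp_add]
  exact IsCompletelyPositive.add hφ hψ

omit [FiniteDimensional ℂ A] in
theorem isCopositive_zero (b : OrthonormalBasis ι ℂ H) :
    IsCopositive b (0 : A →ₗ[ℂ] (H →L[ℂ] H)) := by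
  rw [IsCopositive, LinearMap.comp_zero]
  exact isCompletelyPositive_zero

/-- A nonzero `2`-co-positive map majorizes a nonzero co-positive map. -/
theorem IsKCopositive.exists_copositive_le {b : OrthonormalBasis ι ℂ H}
    {φ : A →ₗ[ℂ] (H →L[ℂ] H)} (hφ : IsKCopositive b 2 φ) (hφ0 : φ ≠ 0) :
    ∃ ψ : A →ₗ[ℂ] (H →L[ℂ] H), IsCopositive b ψ ∧ Majorizes φ ψ ∧ ψ ≠ 0 := by
  obtain ⟨ψ, hψ, hle, hψ0⟩ := IsKPositive.exists_completelyPositive_le hφ fun h => hφ0 <| by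
    rw [← transposeMap_comp_transposeMap_comp b φ, h, LinearMap.comp_zero]
  refine ⟨transposeMap b ∘ₗ ψ, ?_, fun a ha => ?_, fun h => hψ0 ?_⟩
  · rwa [IsCopositive, transposeMap_comp_transposeMap_comp]
  · have h := transposeMap_nonneg b (hle a ha)
    rwa [LinearMap.sub_apply, map_sub, LinearMap.comp_apply, transposeMap_transposeMap] at h
  · rw [← transposeMap_comp_transposeMap_comp b ψ, h, LinearMap.comp_zero]

/-- A nonzero bi-optimal map is atomic. -/
theorem IsBioptimal.isAtomic {b : OrthonormalBasis ι ℂ H} {β : A →ₗ[ℂ] (H →L[ℂ] H)}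
    (hβ : IsBioptimal b β) (hβ0 : β ≠ 0) : IsAtomic b β := by
  rintro ⟨φ₁, φ₂, h₁, h₂, rfl⟩
  have hp₁ := h₁.isPositive
  have hp₂ := h₂.isPositive
  by_cases h0 : φ₁ = 0
  · subst h0
    rw [zero_add] at hβ hβ0
    obtain ⟨ψ, hψ, hle, hψ0⟩ := h₂.exists_copositive_le hβ0
    exact hψ0 (hβ.2 ψ hψ hle)
  · obtain ⟨ψ, hψ, hle, hψ0⟩ := h₁.exists_completelyPositive_le h0
    refine hψ0 (hβ.1 ψ hψ ?_)
    have h := IsPositive.add hle hp₂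
    rwa [sub_add_eq_add_sub] at h

omit [PartialOrder A] [StarOrderedRing A] [FiniteDimensional ℂ A] [FiniteDimensional ℂ H] in
theorem continuous_cstarMatrix_map {V : Type*} [NormedAddCommGroup V] [NormedSpace ℂ V]
    [FiniteDimensional ℂ V] (L : V →ₗ[ℂ] A →ₗ[ℂ] (H →L[ℂ] H)) {k : ℕ}
    (M : CStarMatrix (Fin k) (Fin k) A) :
    Continuous fun v => M.map (L v) := by
  let F : V →ₗ[ℂ] CStarMatrix (Fin k) (Fin k) (H →L[ℂ] H) :=
    { toFun := fun v => M.map (L v)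
      map_add' := fun v w => by
        ext1 i j
        simp
      map_smul' := fun c v => by
        ext1 i j
        simp }
  exact F.continuous_of_finiteDimensional

-- The linear parametrisation `L` lets one statement serve both the completely positive component of
-- a pair and the transposed co-positive one.
omit [FiniteDimensional ℂ A] [FiniteDimensional ℂ H] in
theorem isClosed_isCompletelyPositive {V : Type*} [NormedAddCommGroup V] [NormedSpace ℂ V]
    [FiniteDimensional ℂ V] (L : V →ₗ[ℂ] A →ₗ[ℂ] (H →L[ℂ] H)) :
    IsClosed {v | IsCompletelyPositive (L v)} := by
  simp only [IsCompletelyPositive, IsKPositive, Set.ofPred_forall]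
  exact isClosed_iInter fun k => isClosed_iInter fun M => isClosed_iInter fun _ =>
    CStarAlgebra.isClosed_nonneg.preimage (continuous_cstarMatrix_map L M)

omit [StarOrderedRing A] [FiniteDimensional ℂ A] [FiniteDimensional ℂ H] in
theorem isClosed_majorizes {V : Type*} [NormedAddCommGroup V] [NormedSpace ℂ V]
    [FiniteDimensional ℂ V] (φ : A →ₗ[ℂ] (H →L[ℂ] H)) (L : V →ₗ[ℂ] A →ₗ[ℂ] (H →L[ℂ] H)) :
    IsClosed {v | Majorizes φ (L v)} := by
  simp only [Majorizes, IsPositive, Set.ofPred_forall]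
  refine isClosed_iInter fun a => isClosed_iInter fun _ => ?_
  have h : Continuous fun v => L v a :=
    (LinearMap.applyₗ a ∘ₗ L).continuous_of_finiteDimensional
  exact CStarAlgebra.isClosed_nonneg.preimage ((continuous_const (y := φ a)).sub h)

/-- A positive map majorizes a maximal decomposable map. -/
theorem IsPositive.exists_isMaximalDecomposable (b : OrthonormalBasis ι ℂ H)
    {φ : A →ₗ[ℂ] (H →L[ℂ] H)} (hφ : IsPositive φ) : ∃ α, IsMaximalDecomposable b φ α := by
  let V := A →L[ℂ] (H →L[ℂ] H)
  have : FiniteDimensional ℂ V := inferInstance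
  have : ProperSpace (V × V) := FiniteDimensional.proper ℂ (V × V)
  let ofV : V →ₗ[ℂ] A →ₗ[ℂ] (H →L[ℂ] H) := LinearMap.toContinuousLinearMap.symm.toLinearMap
  let toV : (A →ₗ[ℂ] (H →L[ℂ] H)) → V := fun ψ => LinearMap.toContinuousLinearMap ψ
  have hto : ∀ ψ, ofV (toV ψ) = ψ := fun ψ => rfl
  let L₁ := ofV ∘ₗ LinearMap.fst ℂ V V
  let L₂ := ofV ∘ₗ LinearMap.snd ℂ V V
  -- Pairs are used instead of their sums because each condition on a pair is visibly closed.
  let Q : Set (V × V) := {p | IsCompletelyPositive (L₁ p)} ∩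
    {p | IsCompletelyPositive ((LinearMap.llcomp ℂ A _ _ (transposeMap b) ∘ₗ L₂) p)} ∩
    {p | Majorizes φ ((L₁ + L₂) p)}
  have hQ : ∀ p, p ∈ Q ↔ IsCompletelyPositive (ofV p.1) ∧ IsCopositive b (ofV p.2) ∧
      Majorizes φ (ofV p.1 + ofV p.2) := fun p => and_assoc
  have hQcl : IsClosed Q := ((isClosed_isCompletelyPositive _).inter
    (isClosed_isCompletelyPositive _)).inter (isClosed_majorizes _ _)
  have hbd : ∀ v : V, IsPositive (ofV v) → Majorizes φ (ofV v) → ‖v‖ ≤ 4 * ‖toV φ‖ := by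
    intro v hv hle
    refine v.opNorm_le_bound (by positivity) fun a => ?_
    exact norm_apply_le_of_majorizes (Φ := toV φ) hv hle a
  have hQc : IsCompact Q := by
    refine Metric.isCompact_of_isClosed_isBounded hQcl
      (isBounded_iff_forall_norm_le.2 ⟨4 * ‖toV φ‖, fun p hp => ?_⟩)
    obtain ⟨h₁, h₂, hle⟩ := (hQ p).1 hp
    rw [Prod.norm_def]
    refine max_le (hbd _ h₁.isPositive ?_) (hbd _ h₂.isPositive ?_)
    · have h := IsPositive.add hle h₂.isPositive
      rwa [sub_add, add_sub_cancel_right] at h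
    · have h := IsPositive.add hle h₁.isPositive
      rwa [sub_add, add_sub_cancel_left] at h
  have hQne : Q.Nonempty := by
    refine ⟨0, (hQ 0).2 ⟨isCompletelyPositive_zero, isCopositive_zero b, ?_⟩⟩
    rw [Prod.fst_zero, Prod.snd_zero, map_zero, add_zero, Majorizes, sub_zero]
    exact hφ
  -- A positive map is zero once it vanishes at `1`, so a strictly larger decomposable map would
  -- have strictly larger `τ`-value at `1`.
  obtain ⟨τ, hτ⟩ := exists_faithful_functional (A := H →L[ℂ] H)
  have hcont : Continuous fun p : V × V => τ ((p.1 + p.2) 1) := by fun_prop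
  obtain ⟨p, hp, hmax⟩ := hQc.exists_isMaxOn hQne hcont.continuousOn
  obtain ⟨h₁, h₂, hle⟩ := (hQ p).1 hp
  refine ⟨ofV p.1 + ofV p.2, ⟨_, _, h₁, h₂, rfl⟩, hle, ?_⟩
  rintro ⟨ψ, ⟨ψ₁, ψ₂, hψ₁, hψ₂, rfl⟩, hne, hge, hψle⟩
  have hmem : (toV ψ₁, toV ψ₂) ∈ Q := (hQ _).2 ⟨hψ₁, hψ₂, hψle⟩
  have h : τ ((ψ₁ + ψ₂) 1) ≤ τ ((ofV p.1 + ofV p.2) 1) := hmax hmem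
  refine hne (sub_eq_zero.1 (hge.eq_zero_of_apply_one ?_))
  by_contra h0
  have hpos := hτ _ (hge 1 zero_le_one) h0
  rw [LinearMap.sub_apply, map_sub] at hpos
  linarith

omit [FiniteDimensional ℂ A] in
/-- The complement of a maximal decomposable map majorized by `φ` is bi-optimal. -/
theorem IsMaximalDecomposable.isBioptimal {b : OrthonormalBasis ι ℂ H}
    {φ α : A →ₗ[ℂ] (H →L[ℂ] H)} (hα : IsMaximalDecomposable b φ α) : IsBioptimal b (φ - α) := by
  obtain ⟨⟨α₁, α₂, h₁, h₂, rfl⟩, -, hmax⟩ := hα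
  constructor
  · intro ψ hψ hle
    by_contra hψ0
    refine hmax ⟨α₁ + α₂ + ψ, ⟨α₁ + ψ, α₂, h₁.add hψ, h₂, by abel⟩, by simpa using hψ0, ?_, ?_⟩
    · rw [Majorizes, add_sub_cancel_left]
      exact hψ.isPositive
    · rwa [Majorizes, ← sub_sub]
  · intro ψ hψ hle
    by_contra hψ0
    refine hmax ⟨α₁ + α₂ + ψ, ⟨α₁, α₂ + ψ, h₁, h₂.add hψ, by abel⟩, by simpa using hψ0, ?_, ?_⟩
    · rw [Majorizes, add_sub_cancel_left]
      exact hψ.isPositive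
    · rwa [Majorizes, ← sub_sub]

end

end PositiveMap

theorem theorem4 {A : Type*} [CStarAlgebra A] [PartialOrder A] [StarOrderedRing A]
    [FiniteDimensional ℂ A]
    {H : Type*} [NormedAddCommGroup H] [InnerProductSpace ℂ H] [CompleteSpace H]
    [FiniteDimensional ℂ H]
    {ι : Type*} [Fintype ι] [DecidableEq ι] (b : OrthonormalBasis ι ℂ H)
    (φ : A →ₗ[ℂ] (H →L[ℂ] H)) (hφ : PositiveMap.IsPositive φ) :
    ∃ α β : A →ₗ[ℂ] (H →L[ℂ] H),
      PositiveMap.IsMaximalDecomposable b φ α ∧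
      PositiveMap.IsPositive β ∧
      PositiveMap.IsBioptimal b β ∧
      (β ≠ 0 → PositiveMap.IsAtomic b β) ∧
      φ = α + β := by
  obtain ⟨α, hα⟩ := hφ.exists_isMaximalDecomposable b
  exact ⟨α, φ - α, hα, hα.2.1, hα.isBioptimal, hα.isBioptimal.isAtomic,
    (add_sub_cancel α φ).symm⟩
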